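/- For a real normed space $X$ and a closed subspace $Y\subset X$, a projection of $X$ onto $Y$ is a bounded linear operator $P:X\to Y$ with $P|_Y=\mathrm{id}_Y$, and the relative projection constant is $$\lambda(Y,X)=\inf\{\|P\| : P \text{ is a projection of } X \text{ onto } Y\}.$$ For every integer $n\ge 4$ there exists an $n$-dimensional real normed space $X$ such that $$\lambda(Y,X) > 1+\left(2(n+3)^2\right)^{-100(n+3)^2}$$ for every $(n-1)$-dimensional subspace $Y$ of $X$. Explicitly, one may take $X=(\mathbb{R}^n,\|\cdot\|)$ with $$\|x\|=\Big(\sum_{i=1}^{n+2}|f_i(x)|^{2p}\Big)^{\frac1{2p}},\qquad p=\Big\lceil \frac{n+2}{2}\Big\rceil,$$ where $f_i(x)=x_i$ for $1\le i\le n$, $f_{n+1}(x)=x_1+x_2+\dots+x_n$ and $f_{n+2}(x)=\frac1n(x_1+2x_2+\dots+nx_n)$. -/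

import Mathlib

/-- The bounded linear projections of `X` onto its subspace `Y`: the bounded linear operators
`P : X → Y` whose restriction to `Y` is the identity. -/
def projections {X : Type*} [NormedAddCommGroup X] [NormedSpace ℝ X] (Y : Submodule ℝ X) :
    Set (X →L[ℝ] Y) :=
  {P | ∀ y : Y, P y = y}

/-- In a finite-dimensional space every subspace is the range of a bounded projection, so the
infimum in `relProjConst` is then taken over a nonempty set (bounded below by `0`). -/
theorem projections_nonempty {X : Type*} [NormedAddCommGroup X] [NormedSpace ℝ X]
    [FiniteDimensional ℝ X] (Y : Submodule ℝ X) : (projections Y).Nonempty :=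
  Submodule.ClosedComplemented.of_finiteDimensional Y

/-- The relative projection constant `λ(Y, X)`: the infimum of the operator norms of all bounded
projections of `X` onto `Y`. -/
noncomputable def relProjConst {X : Type*} [NormedAddCommGroup X] [NormedSpace ℝ X]
    (Y : Submodule ℝ X) : ℝ :=
  sInf ((fun P : X →L[ℝ] Y => ‖P‖) '' projections Y)

/-- The `n + 2` linear functionals on `ℝⁿ`: the `n` coordinates, then `x₁ + ⋯ + xₙ`, then
`(x₁ + 2 x₂ + ⋯ + n xₙ) / n`. (Indices start at `0`, so the coordinate `x j` carries the
weight `j + 1`.) -/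
noncomputable def functionals (n : ℕ) : Fin (n + 2) → ((Fin n → ℝ) →ₗ[ℝ] ℝ) :=
  Fin.append (fun i : Fin n => LinearMap.proj i)
    ![∑ j : Fin n, LinearMap.proj j,
      (n : ℝ)⁻¹ • ∑ j : Fin n, ((j : ℝ) + 1) • LinearMap.proj j]

/-- The exponent `p = ⌈(n + 2) / 2⌉`. -/
noncomputable def halfExponent (n : ℕ) : ℕ := ⌈((n : ℝ) + 2) / 2⌉₊

/-- The norm `(∑ |fᵢ(x)|^(2p))^(1/(2p))` on `ℝⁿ`, where `f₁, …, fₙ₊₂` are the above functionals and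
`p = ⌈(n + 2) / 2⌉`. -/
noncomputable def explicitNorm (n : ℕ) (x : Fin n → ℝ) : ℝ :=
  (∑ i : Fin (n + 2), |functionals n i x| ^ (2 * halfExponent n)) ^
    (1 / (2 * (halfExponent n : ℝ)))

/-! Let the hyperplane `Y` be the kernel of `g`, and let `P` be a projection onto it that kills the
unit vector `v`. Since `P (y + t • v) = y` on `Y`, a norm of `P` close to 1 means that `‖y + t • v‖`
can hardly drop below `‖y‖`. So the derivative at `y` along `v` of the `(m + 1)`-st power of the
norm, `m + 1 = 2p`, is almost zero: the degree `m` form `∑ f j v * f j y ^ m` almost vanishes on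
`Y`. An `m`-fold finite difference refutes this. Along directions in `Y` on which `f i` is 1, while
every other `f j` vanishes on at least one of them, only `± m! * f i v` survives. The directions
exist if `g` is not close to the span of `f i` and any other `f j`. As `n ≥ 4` and any `n` forms are
independent, `g` is close to the span of at most one pair, unless it is close to a multiple of a
single `f k`. The `n` forms outside that pair control `v`, so one of them is not small at `v` and
serves as `f i`. In the exceptional case `f k` is small on `Y` and its term is negligible.
`exists_le_abs_gradient` is the quantitative version, `exists_norm_add_smul_pow_le` turns it into a
decrease of the norm, and `normingForms_functionals` verifies general position for the explicit
forms. -/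

section FiniteDifferences

/-! ### Iterated finite differences of powers of linear forms. -/

variable {X : Type*} [AddCommGroup X] [Module ℝ X]

/-- A linear form that vanishes on one of the directions does not contribute to the iterated
finite difference of its power. -/
theorem alternating_sum_pow_eq_zero {m : ℕ} (f : X →ₗ[ℝ] ℝ) (w : Fin m → X) (t : Fin m)
    (ht : f (w t) = 0) :
    ∑ S : Finset (Fin m), (-1 : ℝ) ^ S.card * f (∑ s ∈ S, w s) ^ m = 0 := by
  rw [← Finset.powerset_univ, ← Finset.insert_erase (Finset.mem_univ t),
    Finset.sum_powerset_insert (Finset.notMem_erase t _), ← Finset.sum_add_distrib]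
  refine Finset.sum_eq_zero fun S hS => ?_
  have htS : t ∉ S := fun h => Finset.notMem_erase t _ (Finset.mem_powerset.1 hS h)
  rw [Finset.card_insert_of_notMem htS, Finset.sum_insert htS, map_add, ht]
  ring

/-- The iterated finite difference of the `m`-th power of a linear form that is `1` on all `m`
directions. -/
theorem alternating_sum_pow_eq_factorial {m : ℕ} (f : X →ₗ[ℝ] ℝ) (w : Fin m → X)
    (hw : ∀ t, f (w t) = 1) :
    ∑ S : Finset (Fin m), (-1 : ℝ) ^ S.card * f (∑ s ∈ S, w s) ^ m =
      (-1) ^ m * (m.factorial : ℝ) := by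
  have h1 := congrFun (fwdDiff_iter_eq_factorial (R := ℝ) (n := m)) 0
  rw [fwdDiff_iter_eq_sum_shift] at h1
  have h2 : ∀ S : Finset (Fin m), (-1 : ℝ) ^ S.card * f (∑ s ∈ S, w s) ^ m =
      (-1 : ℝ) ^ S.card * (S.card : ℝ) ^ m := by
    intro S
    simp [hw]
  simp_rw [h2]
  rw [← Finset.powerset_univ, Finset.sum_powerset_apply_card (fun k => (-1 : ℝ) ^ k * (k : ℝ) ^ m)]
  simp only [Pi.natCast_apply] at h1
  rw [← h1, Finset.mul_sum, Finset.card_univ, Fintype.card_fin]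
  refine Finset.sum_congr rfl fun k hk => ?_
  have hk' : k ≤ m := Nat.lt_succ_iff.1 (Finset.mem_range.1 hk)
  have h3 : (-1 : ℝ) ^ m * (-1) ^ (m - k) = (-1) ^ k := by
    rw [← pow_add, show m + (m - k) = k + 2 * (m - k) by omega, pow_add, pow_mul]
    simp
  simp only [nsmul_eq_mul, zsmul_eq_mul, zero_add, mul_one]
  push_cast
  rw [← h3]
  ring

/-- If only the forms `f i` and `f k` survive the iterated finite difference, then the form
`∑ j, c j * (f j) ^ m` is large at some sum of the directions. -/
theorem exists_le_abs_sum_pow {ι : Type*} [Fintype ι] [DecidableEq ι] (f : ι → X →ₗ[ℝ] ℝ)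
    (c : ι → ℝ) {m : ℕ} (w : Fin m → X) {i k : ι} (hik : i ≠ k) (hi : ∀ t, f i (w t) = 1)
    (hj : ∀ j, j ≠ i → j ≠ k → ∃ t, f j (w t) = 0) {δ η : ℝ}
    (hk : |∑ S : Finset (Fin m), (-1 : ℝ) ^ S.card * f k (∑ s ∈ S, w s) ^ m| ≤ δ)
    (hη : 2 ^ m * η ≤ |c i| - |c k| * δ) :
    ∃ S : Finset (Fin m), η ≤ |∑ j, c j * f j (∑ s ∈ S, w s) ^ m| := by
  by_contra! hS
  set A : ι → ℝ := fun j => ∑ S : Finset (Fin m), (-1 : ℝ) ^ S.card * f j (∑ s ∈ S, w s) ^ m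
    with hA
  have h1 : ∑ S : Finset (Fin m), (-1 : ℝ) ^ S.card * ∑ j, c j * f j (∑ s ∈ S, w s) ^ m =
      c i * A i + c k * A k := by
    have : ∑ S : Finset (Fin m), (-1 : ℝ) ^ S.card * ∑ j, c j * f j (∑ s ∈ S, w s) ^ m =
        ∑ j, c j * A j := by
      simp only [hA, Finset.mul_sum]
      rw [Finset.sum_comm]
      refine Finset.sum_congr rfl fun j _ => Finset.sum_congr rfl fun S _ => by ring
    rw [this, ← Finset.sum_pair (f := fun j => c j * A j) hik]
    symm
    refine Finset.sum_subset (Finset.subset_univ _) fun j _ hj' => ?_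
    simp only [Finset.mem_insert, Finset.mem_singleton, not_or] at hj'
    obtain ⟨t, ht⟩ := hj j hj'.1 hj'.2
    simp only [hA]
    rw [alternating_sum_pow_eq_zero (f j) w t ht, mul_zero]
  have h2 : |∑ S : Finset (Fin m), (-1 : ℝ) ^ S.card * ∑ j, c j * f j (∑ s ∈ S, w s) ^ m| <
      2 ^ m * η := by
    refine (Finset.abs_sum_le_sum_abs _ _).trans_lt ?_
    refine (Finset.sum_lt_sum_of_nonempty Finset.univ_nonempty (g := fun _ => η)
      fun S _ => ?_).trans_eq ?_
    · rw [abs_mul, abs_pow, abs_neg, abs_one, one_pow, one_mul]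
      exact hS S
    · simp
  have h3 : |A i| = m.factorial := by
    simp only [hA]
    rw [alternating_sum_pow_eq_factorial (f i) w hi, abs_mul, abs_pow, abs_neg, abs_one, one_pow,
      one_mul, Nat.abs_cast]
  have h4 : (1 : ℝ) ≤ |A i| := by
    rw [h3]
    exact_mod_cast Nat.one_le_iff_ne_zero.2 m.factorial_ne_zero
  have h5 : |c i| * |A i| - |c k| * |A k| ≤ |c i * A i + c k * A k| := by
    rw [← abs_mul, ← abs_mul]
    have := abs_sub_abs_le_abs_sub (c i * A i) (-(c k * A k))
    rwa [abs_neg, sub_neg_eq_add] at this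
  have h6 : |c k| * |A k| ≤ |c k| * δ := mul_le_mul_of_nonneg_left hk (abs_nonneg _)
  have h7 : |c i| ≤ |c i| * |A i| := le_mul_of_one_le_right (abs_nonneg _) h4
  rw [h1] at h2
  linarith

end FiniteDifferences

/-! ### Elementary power estimates. -/

section Taylor

/-- The bracket on the right is the same second-order remainder at `|a|` with increment 1; both
remainders obey the same recursion in `m`. -/
theorem abs_add_pow_sub_le (a d : ℝ) (hd : |d| ≤ 1) (m : ℕ) :
    |(a + d) ^ (m + 1) - a ^ (m + 1) - (m + 1) * a ^ m * d| ≤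
      d ^ 2 * ((|a| + 1) ^ (m + 1) - |a| ^ (m + 1) - (m + 1) * |a| ^ m) := by
  induction m with
  | zero => simp
  | succ m ih =>
    have h1 : (a + d) ^ (m + 1 + 1) - a ^ (m + 1 + 1) - ((m + 1 : ℕ) + 1) * a ^ (m + 1) * d =
        (a + d) * ((a + d) ^ (m + 1) - a ^ (m + 1) - (m + 1) * a ^ m * d) +
          (m + 1) * a ^ m * d ^ 2 := by
      push_cast; ring
    have h2 : d ^ 2 * ((|a| + 1) ^ (m + 1 + 1) - |a| ^ (m + 1 + 1) -
        ((m + 1 : ℕ) + 1) * |a| ^ (m + 1)) =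
        (|a| + 1) * (d ^ 2 * ((|a| + 1) ^ (m + 1) - |a| ^ (m + 1) - (m + 1) * |a| ^ m)) +
          (m + 1) * |a| ^ m * d ^ 2 := by
      push_cast; ring
    rw [h1, h2]
    refine (abs_add_le _ _).trans (add_le_add ?_ ?_)
    · rw [abs_mul]
      gcongr
      exact (abs_add_le a d).trans (by gcongr)
    · rw [abs_mul, abs_mul, abs_pow, abs_of_nonneg (sq_nonneg d),
        abs_of_nonneg (by positivity : (0 : ℝ) ≤ m + 1)]

theorem add_pow_le_taylor {a d : ℝ} (hd : |d| ≤ 1) (m : ℕ) :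
    (a + d) ^ (m + 1) ≤ a ^ (m + 1) + (m + 1) * a ^ m * d + d ^ 2 * (|a| + 1) ^ (m + 1) := by
  have h := (abs_le.1 (abs_add_pow_sub_le a d hd m)).2
  have : d ^ 2 * ((|a| + 1) ^ (m + 1) - |a| ^ (m + 1) - (m + 1) * |a| ^ m) ≤
      d ^ 2 * (|a| + 1) ^ (m + 1) := by
    gcongr
    have : 0 ≤ |a| ^ (m + 1) := by positivity
    have : 0 ≤ (m + 1) * |a| ^ m := by positivity
    linarith
  linarith

theorem one_add_pow_le_one_add_two_pow_sub_one_mul {x : ℝ} (h0 : 0 ≤ x) (h1 : x ≤ 1) (q : ℕ) :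
    (1 + x) ^ q ≤ 1 + (2 ^ q - 1) * x := by
  induction q with
  | zero => simp
  | succ q ih =>
    have h2 : (0 : ℝ) ≤ 2 ^ q - 1 := sub_nonneg.2 (one_le_pow₀ (by norm_num))
    calc (1 + x) ^ (q + 1) = (1 + x) ^ q * (1 + x) := pow_succ _ _
      _ ≤ (1 + (2 ^ q - 1) * x) * (1 + x) := by gcongr
      _ = 1 + 2 ^ q * x + (2 ^ q - 1) * x * x := by ring
      _ ≤ 1 + 2 ^ q * x + (2 ^ q - 1) * x * 1 := by gcongr
      _ = 1 + (2 ^ (q + 1) - 1) * x := by ring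

end Taylor

/-! ### Forms in general position and the gradient on a hyperplane. -/

/-- A finite family of linear forms whose `ℓ`-norm with the even exponent `m + 1` is the norm of
the space, and which is quantitatively in general position: all but two of the forms have a dual
basis whose members have norm at most `K`, and any vector is controlled by the values of all but
two of the forms. -/
structure NormingForms {ι X : Type*} [Fintype ι] [NormedAddCommGroup X] [NormedSpace ℝ X]
    (f : ι → X →ₗ[ℝ] ℝ) (m : ℕ) (K M : ℝ) : Prop where
  odd : Odd m
  six_le_card : 6 ≤ Fintype.card ι
  card_le : Fintype.card ι ≤ m + 1
  one_le_K : 1 ≤ K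
  K_le : 4 * K + 1 ≤ M
  exponent_le : (m : ℝ) + 1 ≤ M
  -- This is `2 * (4 + 3) ^ 2`, the value of `M` for the explicit forms when `n = 4`.
  le_M : 98 ≤ M
  norm_pow : ∀ x, ‖x‖ ^ (m + 1) = ∑ i, f i x ^ (m + 1)
  abs_le : ∀ i x, |f i x| ≤ ‖x‖
  dual : ∀ i a b, i ≠ a → i ≠ b → a ≠ b →
    ∃ e, f i e = 1 ∧ (∀ j, j ≠ i → j ≠ a → j ≠ b → f j e = 0) ∧ ‖e‖ ≤ K
  norm_le : ∀ a b, a ≠ b → ∀ x, ∃ k, k ≠ a ∧ k ≠ b ∧ ‖x‖ ≤ M * |f k x|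

namespace NormingForms

variable {ι X : Type*} [Fintype ι] [NormedAddCommGroup X] [NormedSpace ℝ X]
  {f : ι → X →ₗ[ℝ] ℝ} {m : ℕ} {K M : ℝ}

/-- With at least six forms, the two that `dual` leaves uncontrolled can be chosen outside `i, j, k,
l`. The indices `j, k, l` may coincide. -/
theorem exists_dual (hf : NormingForms f m K M) {i j k l : ι} (hj : i ≠ j) (hk : i ≠ k)
    (hl : i ≠ l) : ∃ e, f i e = 1 ∧ f j e = 0 ∧ f k e = 0 ∧ f l e = 0 ∧ ‖e‖ ≤ K := by
  classical
  have hcard : 1 < (Finset.univ \ {i, j, k, l} : Finset ι).card := by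
    have h1 := Finset.le_card_sdiff ({i, j, k, l} : Finset ι) Finset.univ
    have h2 : ({i, j, k, l} : Finset ι).card ≤ 4 := Finset.card_le_four
    have h3 := hf.six_le_card
    rw [Finset.card_univ] at h1
    omega
  obtain ⟨a, ha, b, hb, hab⟩ := Finset.one_lt_card.1 hcard
  simp only [Finset.mem_sdiff, Finset.mem_univ, true_and, Finset.mem_insert,
    Finset.mem_singleton, not_or] at ha hb
  obtain ⟨e, h1, h2, h3⟩ := hf.dual i a b (Ne.symm ha.1) (Ne.symm hb.1) hab
  exact ⟨e, h1, h2 j hj.symm (Ne.symm ha.2.1) (Ne.symm hb.2.1),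
    h2 k hk.symm (Ne.symm ha.2.2.1) (Ne.symm hb.2.2.1),
    h2 l hl.symm (Ne.symm ha.2.2.2) (Ne.symm hb.2.2.2), h3⟩

/-- If `g` is not small on the common kernel of `f i` and `f j`, then the kernel of `g` contains
a vector of controlled norm that is killed by `f j` but not by `f i`. -/
theorem exists_mem_ker (hf : NormingForms f m K M) {g : X →ₗ[ℝ] ℝ} (hg : ∀ x, |g x| ≤ ‖x‖)
    {i j : ι} (hij : i ≠ j) {u : X} (hi : f i u = 0) (hj : f j u = 0) {β : ℝ} (hβ : 0 < β)
    (hu : β * ‖u‖ < |g u|) :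
    ∃ w, g w = 0 ∧ f i w = 1 ∧ f j w = 0 ∧ ‖w‖ ≤ K + K / β := by
  obtain ⟨e, h1, h2, -, -, h3⟩ := hf.exists_dual hij hij hij
  have hpos : 0 < |g u| := lt_of_le_of_lt (by positivity) hu
  have hne : g u ≠ 0 := abs_pos.1 hpos
  refine ⟨e - (g e / g u) • u, by simp [hne], by simp [h1, hi], by simp [h2, hj], ?_⟩
  refine (norm_sub_le _ _).trans (add_le_add h3 ?_)
  rw [norm_smul, Real.norm_eq_abs, abs_div, div_mul_eq_mul_div, div_le_div_iff₀ hpos hβ]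
  have hK := hf.one_le_K
  calc |g e| * ‖u‖ * β = |g e| * (β * ‖u‖) := by ring
    _ ≤ K * |g u| := mul_le_mul ((hg e).trans h3) hu.le (by positivity) (by linarith)

variable [DecidableEq ι]

/-- The finite difference argument for given directions. The index `k` is the one form that need not
be killed, provided that it is negligible on the kernel of `g`. -/
theorem exists_le_abs_gradient_of_directions (hf : NormingForms f m K M) {g : X →ₗ[ℝ] ℝ} {v : X}
    (hv : ‖v‖ = 1) {i k : ι} (hik : i ≠ k) (hiv : ‖v‖ ≤ M * |f i v|) {B : ℝ} {w : ι → X}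
    (hw : ∀ j, j ≠ i → g (w j) = 0 ∧ f i (w j) = 1 ∧ ‖w j‖ ≤ B ∧ (j ≠ k → f j (w j) = 0))
    (hk : f k (w k) = 0 ∨ ∀ y, g y = 0 → ‖y‖ ≤ m * B → 2 ^ m * |f k y| ^ m ≤ 1 / (2 * M)) :
    ∃ y, g y = 0 ∧ ‖y‖ ≤ m * B ∧ 1 / (M * 2 ^ (m + 1)) ≤ |∑ j, f j v * f j y ^ m| := by
  have hM : 0 < M := by linarith [hf.le_M]
  have : Nonempty {j // j ≠ i} := ⟨⟨k, hik.symm⟩⟩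
  -- There may be more than `card ι - 1` slots, so directions are allowed to repeat.
  obtain ⟨σ, hσ⟩ : ∃ σ : Fin m → {j // j ≠ i}, Function.Surjective σ := by
    have hcard : Fintype.card {j // j ≠ i} ≤ Fintype.card (Fin m) := by
      rw [Fintype.card_subtype_compl, Fintype.card_subtype_eq, Fintype.card_fin]
      have := hf.card_le
      omega
    obtain ⟨e⟩ := Function.Embedding.nonempty_of_card_le hcard
    exact ⟨Function.invFun e, Function.invFun_surjective e.injective⟩
  have hB : 0 ≤ B := (norm_nonneg _).trans (hw k hik.symm).2.2.1
  have hg0 : ∀ S : Finset (Fin m), g (∑ s ∈ S, w (σ s)) = 0 := fun S => by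
    rw [map_sum]
    exact Finset.sum_eq_zero fun s _ => (hw _ (σ s).2).1
  have hnorm : ∀ S : Finset (Fin m), ‖∑ s ∈ S, w (σ s)‖ ≤ m * B := fun S => by
    refine (norm_sum_le _ _).trans ?_
    refine (Finset.sum_le_card_nsmul _ _ B fun s _ => (hw _ (σ s).2).2.2.1).trans ?_
    rw [nsmul_eq_mul]
    gcongr
    simpa using Finset.card_le_univ S
  have hkS : |∑ S : Finset (Fin m), (-1 : ℝ) ^ S.card * f k (∑ s ∈ S, w (σ s)) ^ m| ≤
      1 / (2 * M) := by
    rcases hk with hk | hk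
    · obtain ⟨t, ht⟩ := hσ ⟨k, hik.symm⟩
      rw [alternating_sum_pow_eq_zero (f k) (fun s => w (σ s)) t (by rw [ht]; exact hk), abs_zero]
      positivity
    · refine (Finset.abs_sum_le_sum_abs _ _).trans ?_
      refine (Finset.sum_le_card_nsmul _ _ (1 / (2 * M) / 2 ^ m) fun S _ => ?_).trans ?_
      · rw [abs_mul, abs_pow, abs_neg, abs_one, one_pow, one_mul, abs_pow,
          le_div_iff₀ (by positivity), mul_comm]
        exact hk _ (hg0 S) (hnorm S)
      · rw [Finset.card_univ, Fintype.card_finset, Fintype.card_fin, nsmul_eq_mul]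
        push_cast
        rw [mul_div_cancel₀ _ (by positivity)]
  obtain ⟨S, hS⟩ := exists_le_abs_sum_pow (η := 1 / (M * 2 ^ (m + 1))) f (fun j => f j v)
    (fun s => w (σ s)) hik
    (fun t => (hw _ (σ t).2).2.1) (fun j hji hjk => by
      obtain ⟨t, ht⟩ := hσ ⟨j, hji⟩
      exact ⟨t, by rw [ht]; exact (hw j hji).2.2.2 hjk⟩) hkS (by
      have h1 : |f k v| * (1 / (2 * M)) ≤ 1 * (1 / (2 * M)) := by
        gcongr
        exact (hf.abs_le k v).trans_eq hv
      have h2 : 1 / M ≤ |f i v| := by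
        rw [div_le_iff₀ hM, mul_comm, ← hv]
        exact hiv
      have h3 : 2 ^ m * (1 / (M * 2 ^ (m + 1))) = 1 / M - 1 * (1 / (2 * M)) := by
        field_simp
        ring
      rw [h3]
      linarith)
  exact ⟨_, hg0 S, hnorm S, hS⟩

/-- The case of a functional `g` that is close to a multiple of some `f k`. -/
theorem exists_le_abs_gradient_of_small_on_ker (hf : NormingForms f m K M) {g : X →ₗ[ℝ] ℝ}
    (hg : ∀ x, |g x| ≤ ‖x‖) {x₀ : X} (hx₀ : ‖x₀‖ ≤ 1) (hgx₀ : 1 / 2 ≤ |g x₀|) {v : X}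
    (hv : ‖v‖ = 1) {k : ι} (hk : ∀ u, f k u = 0 → |g u| ≤ 1 / M ^ 6 * ‖u‖) :
    ∃ y, g y = 0 ∧ ‖y‖ ≤ M ^ 10 ∧ 1 / (M * 2 ^ (m + 1)) ≤ |∑ j, f j v * f j y ^ m| := by
  have hK := hf.one_le_K
  have hKM := hf.K_le
  have hM := hf.le_M
  have hmM := hf.exponent_le
  have hM0 : 0 < M := by linarith
  have hm0 : 1 ≤ m := hf.odd.pos
  -- Since `x - f k x • e` lies in the kernel of `f k`, the functional `g` is almost `g e` times `f
  -- k`.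
  have hproj : ∀ e, f k e = 1 → ‖e‖ ≤ K → ∀ x,
      |g x - f k x * g e| ≤ 1 / M ^ 6 * ((1 + K) * ‖x‖) := by
    intro e he heK x
    have h1 := hk (x - f k x • e) (by simp [he])
    rw [map_sub, map_smul, smul_eq_mul] at h1
    refine h1.trans ?_
    gcongr
    refine (norm_sub_le _ _).trans ?_
    rw [norm_smul, Real.norm_eq_abs]
    have := mul_le_mul (hf.abs_le k x) heK (norm_nonneg _) (norm_nonneg _)
    linarith
  have hα : 1 / M ^ 6 * (1 + K) ≤ 1 / 4 := by
    rw [div_mul_eq_mul_div, one_mul, div_le_iff₀ (by positivity)]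
    have : M ^ 2 ≤ M ^ 6 := pow_le_pow_right₀ (by linarith) (by norm_num)
    nlinarith
  have hge : ∀ e, f k e = 1 → ‖e‖ ≤ K → 1 / 4 ≤ |g e| := by
    intro e he heK
    have h1 := hproj e he heK x₀
    have h2 : 1 / M ^ 6 * ((1 + K) * ‖x₀‖) ≤ 1 / 4 := by
      refine le_trans ?_ hα
      gcongr
      exact mul_le_of_le_one_right (by linarith) hx₀
    have h3 : |f k x₀ * g e| ≤ |g e| := by
      rw [abs_mul]
      exact mul_le_of_le_one_left (abs_nonneg _) ((hf.abs_le k x₀).trans hx₀)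
    have h4 := abs_sub_abs_le_abs_sub (g x₀) (f k x₀ * g e)
    linarith
  -- Only `k` has to be avoided; `b` merely completes the pair required by `norm_le`.
  obtain ⟨b, hb⟩ : ∃ b, b ≠ k := by
    have : Nontrivial ι := Fintype.one_lt_card_iff_nontrivial.1 (by linarith [hf.six_le_card])
    exact exists_ne k
  obtain ⟨i, hik, -, hiv⟩ := hf.norm_le k b hb.symm v
  have hdir : ∀ j, j ≠ i → ∃ w, g w = 0 ∧ f i w = 1 ∧ ‖w‖ ≤ K + K / (1 / (8 * K)) ∧
      (j ≠ k → f j w = 0) := by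
    have key : ∀ j, j ≠ i → j ≠ k → ∃ w, g w = 0 ∧ f i w = 1 ∧ ‖w‖ ≤ K + K / (1 / (8 * K)) ∧
      f j w = 0 := by
      intro j hji hjk
      obtain ⟨e, h1, h2, h3, -, h4⟩ := hf.exists_dual hik.symm hjk.symm hjk.symm
      have h5 : 1 / (8 * K) * ‖e‖ < |g e| := by
        refine lt_of_le_of_lt (mul_le_mul_of_nonneg_left h4 (by positivity)) ?_
        refine lt_of_lt_of_le ?_ (hge e h1 h4)
        field_simp
        norm_num
      obtain ⟨w, w1, w2, w3, w4⟩ := hf.exists_mem_ker hg hji.symm h2 h3 (by positivity) h5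
      exact ⟨w, w1, w2, w4, w3⟩
    intro j hji
    by_cases hjk : j = k
    -- The slot of `k` need not kill `f k`, so it borrows the direction of another index.
    · obtain ⟨j', hj'⟩ : ∃ j', j' ∉ ({i, k} : Finset ι) := by
        by_contra! h
        have h1 : (Finset.univ : Finset ι).card ≤ ({i, k} : Finset ι).card :=
          Finset.card_le_card fun x _ => h x
        have h2 : ({i, k} : Finset ι).card ≤ 2 := Finset.card_le_two
        have h3 := hf.six_le_card
        rw [Finset.card_univ] at h1
        omega
      simp only [Finset.mem_insert, Finset.mem_singleton, not_or] at hj'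
      obtain ⟨w, w1, w2, w3, -⟩ := key j' hj'.1 hj'.2
      exact ⟨w, w1, w2, w3, fun h => absurd hjk h⟩
    · obtain ⟨w, w1, w2, w3, w4⟩ := key j hji hjk
      exact ⟨w, w1, w2, w3, fun _ => w4⟩
  choose! w hw using hdir
  have hB : K + K / (1 / (8 * K)) ≤ 2 * M ^ 2 := by
    have : K + K / (1 / (8 * K)) = K * (8 * K + 1) := by field_simp; ring
    rw [this]
    nlinarith
  obtain ⟨y, y1, y2, y3⟩ := hf.exists_le_abs_gradient_of_directions hv hik hiv
    (B := 2 * M ^ 2) (w := w)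
    (fun j hj => ⟨(hw j hj).1, (hw j hj).2.1, (hw j hj).2.2.1.trans hB, (hw j hj).2.2.2⟩)
    (Or.inr fun y hgy hy => by
      obtain ⟨e, h1, -, -, -, h4⟩ := hf.exists_dual hik.symm hik.symm hik.symm
      have h5 := hproj e h1 h4 y
      rw [hgy, zero_sub, abs_neg, abs_mul] at h5
      have h6 : |f k y| * (1 / 4) ≤ |f k y| * |g e| :=
        mul_le_mul_of_nonneg_left (hge e h1 h4) (abs_nonneg _)
      have h7 : (1 + K) * ‖y‖ ≤ (M / 2) * (M * (2 * M ^ 2)) := by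
        gcongr
        · linarith
        · refine hy.trans ?_
          gcongr
          linarith
      have h8 : 1 / M ^ 6 * ((1 + K) * ‖y‖) ≤ 1 / M ^ 6 * ((M / 2) * (M * (2 * M ^ 2))) := by
        gcongr
      have h9 : 1 / M ^ 6 * ((M / 2) * (M * (2 * M ^ 2))) = 1 / M ^ 2 := by
        field_simp
      have h10 : 2 * |f k y| ≤ 8 / M ^ 2 := by
        have : 8 / M ^ 2 = 8 * (1 / M ^ 2) := by ring
        linarith
      have h11 : 8 / M ^ 2 ≤ 1 / (2 * M) := by
        rw [div_le_div_iff₀ (by positivity) (by positivity)]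
        nlinarith
      have h12 : 1 / (2 * M) ≤ 1 := by
        rw [div_le_one (by positivity)]
        linarith
      rw [← mul_pow]
      exact (pow_le_of_le_one (by positivity) (by linarith) (by omega)).trans (by linarith))
  refine ⟨y, y1, y2.trans ?_, y3⟩
  calc (m : ℝ) * (2 * M ^ 2) ≤ M * (M * M ^ 2) := by gcongr <;> linarith
    _ = M ^ 4 := by ring
    _ ≤ M ^ 10 := pow_le_pow_right₀ (by linarith) (by norm_num)

/-- On the kernel of a normalized functional `g`, the derivative of the `(m + 1)`-st power of the
norm in a normalized direction `v` is bounded away from zero. -/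
theorem exists_le_abs_gradient (hf : NormingForms f m K M) {g : X →ₗ[ℝ] ℝ}
    (hg : ∀ x, |g x| ≤ ‖x‖) {x₀ : X} (hx₀ : ‖x₀‖ ≤ 1) (hgx₀ : 1 / 2 ≤ |g x₀|) {v : X}
    (hv : ‖v‖ = 1) :
    ∃ y, g y = 0 ∧ ‖y‖ ≤ M ^ 10 ∧ 1 / (M * 2 ^ (m + 1)) ≤ |∑ j, f j v * f j y ^ m| := by
  by_cases hA : ∃ k, ∀ u, f k u = 0 → |g u| ≤ 1 / M ^ 6 * ‖u‖
  · obtain ⟨k, hk⟩ := hA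
    exact hf.exists_le_abs_gradient_of_small_on_ker hg hx₀ hgx₀ hv hk
  have hK := hf.one_le_K
  have hKM := hf.K_le
  have hM := hf.le_M
  have hmM := hf.exponent_le
  have hM0 : 0 < M := by linarith
  -- A bad pair is one whose span almost contains `g`. The extra factor `1 / M` absorbs the constant
  -- `1 + 2 * K` lost when two bad pairs are combined.
  let bad : ι → ι → Prop := fun i j => ∀ u, f i u = 0 → f j u = 0 → |g u| ≤ 1 / M ^ 7 * ‖u‖
  have bad_symm : ∀ {i j}, bad i j → bad j i := fun h u hi hj => h u hj hi
  have hβ : 1 / M ^ 7 * M = 1 / M ^ 6 := by field_simp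
  -- The kernel of `f i` is the sum of its intersections with the kernels of `f j` and `f k`, so `g`
  -- would be small on all of it, against `hA`.
  have not_bad_of_common : ∀ {i j k}, i ≠ j → i ≠ k → j ≠ k → bad i j → ¬ bad i k := by
    intro i j k hij hik hjk h1 h2
    refine hA ⟨i, fun x hx => ?_⟩
    obtain ⟨e, he, he1, he2, -, heK⟩ := hf.exists_dual hij.symm hjk hjk
    have h3 := h1 (x - f j x • e) (by simp [hx, he1]) (by simp [he])
    have h4 := h2 (f j x • e) (by simp [he1]) (by simp [he2])
    have h5 : ‖f j x • e‖ ≤ K * ‖x‖ := by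
      rw [norm_smul, Real.norm_eq_abs, mul_comm]
      exact mul_le_mul heK (hf.abs_le j x) (abs_nonneg _) (by linarith)
    have h6 := norm_sub_le x (f j x • e)
    have h7 : |g x| ≤ |g (x - f j x • e)| + |g (f j x • e)| := by
      rw [map_sub]
      simpa using abs_add_le (g x - g (f j x • e)) (g (f j x • e))
    calc |g x| ≤ 1 / M ^ 7 * (‖x - f j x • e‖ + ‖f j x • e‖) := by linarith
      _ ≤ 1 / M ^ 7 * (M * ‖x‖) := by
        gcongr
        nlinarith [norm_nonneg x]
      _ = 1 / M ^ 6 * ‖x‖ := by rw [← mul_assoc, hβ]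
  -- The two common kernels span the space, so `g` would be small at `x₀`.
  have not_bad_of_disjoint : ∀ {i j k l}, i ≠ j → i ≠ k → i ≠ l → j ≠ k → j ≠ l →
      bad i j → ¬ bad k l := by
    intro i j k l hij hik hil hjk hjl h1 h2
    obtain ⟨e, he, he1, he2, he3, heK⟩ := hf.exists_dual hij hik hil
    obtain ⟨e', he', he1', he2', he3', heK'⟩ := hf.exists_dual hij.symm hjk hjl
    set z := f i x₀ • e + f j x₀ • e' with hz
    have h3 := h1 (x₀ - z) (by simp [hz, he, he1']) (by simp [hz, he', he1])
    have h4 := h2 z (by simp [hz, he2, he2']) (by simp [hz, he3, he3'])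
    have h5 : ∀ (j : ι) (a : X), ‖a‖ ≤ K → ‖f j x₀ • a‖ ≤ K := by
      intro j a ha
      rw [norm_smul, Real.norm_eq_abs]
      have h := mul_le_mul ((hf.abs_le j x₀).trans hx₀) ha (norm_nonneg _) zero_le_one
      rwa [one_mul] at h
    have h6 : ‖z‖ ≤ 2 * K := by
      have := norm_add_le (f i x₀ • e) (f j x₀ • e')
      linarith [h5 i e heK, h5 j e' heK']
    have h7 := norm_sub_le x₀ z
    have h8 : |g x₀| ≤ |g (x₀ - z)| + |g z| := by
      rw [map_sub]
      simpa using abs_add_le (g x₀ - g z) (g z)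
    have h9 : 1 / M ^ 7 * (‖x₀ - z‖ + ‖z‖) ≤ 1 / M ^ 7 * M := by
      gcongr
      linarith
    have h10 : 1 / M ^ 6 < 1 / 2 := by
      have : M ≤ M ^ 6 := le_self_pow₀ (by linarith) (by norm_num)
      rw [div_lt_div_iff₀ (by positivity) (by positivity)]
      linarith
    linarith
  obtain ⟨a, b, hab, hbad⟩ : ∃ a b, a ≠ b ∧ ∀ i j, i ≠ j → i ≠ a → i ≠ b → ¬ bad i j := by
    by_cases h : ∃ a b, a ≠ b ∧ bad a b
    · obtain ⟨a, b, hab, h⟩ := h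
      refine ⟨a, b, hab, fun i j hij hia hib hij' => ?_⟩
      by_cases hja : j = a
      · subst hja
        exact not_bad_of_common hab hij.symm hib.symm h (bad_symm hij')
      by_cases hjb : j = b
      · subst hjb
        exact not_bad_of_common hab.symm hij.symm hia.symm (bad_symm h) (bad_symm hij')
      exact not_bad_of_disjoint hab (Ne.symm hia) (Ne.symm hja) (Ne.symm hib) (Ne.symm hjb) h hij'
    · have : Nontrivial ι := Fintype.one_lt_card_iff_nontrivial.1 (by linarith [hf.six_le_card])
      obtain ⟨a, b, hab⟩ := exists_pair_ne ι
      exact ⟨a, b, hab, fun i j hij _ _ hij' => h ⟨i, j, hij, hij'⟩⟩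
  obtain ⟨i, hia, hib, hiv⟩ := hf.norm_le a b hab v
  have hdir : ∀ j, j ≠ i → ∃ w, g w = 0 ∧ f i w = 1 ∧ f j w = 0 ∧ ‖w‖ ≤ K + K / (1 / M ^ 7) := by
    intro j hj
    have h := hbad i j hj.symm hia hib
    simp only [bad] at h
    push Not at h
    obtain ⟨u, hu1, hu2, hu3⟩ := h
    exact hf.exists_mem_ker hg hj.symm hu1 hu2 (by positivity) hu3
  choose! w hw using hdir
  obtain ⟨y, y1, y2, y3⟩ := hf.exists_le_abs_gradient_of_directions hv hia hiv (w := w)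
    (fun j hj => ⟨(hw j hj).1, (hw j hj).2.1, (hw j hj).2.2.2, fun _ => (hw j hj).2.2.1⟩)
    -- All forms other than `f i` are killed here, so `a` plays the role of `k` only nominally.
    (Or.inl (hw a hia.symm).2.2.1)
  refine ⟨y, y1, y2.trans ?_, y3⟩
  have h1 : 1 ≤ M ^ 7 := one_le_pow₀ (by linarith)
  calc (m : ℝ) * (K + K / (1 / M ^ 7)) = m * (K * (1 + M ^ 7)) := by field_simp
    _ ≤ M * (M * (M * M ^ 7)) := by
      gcongr
      · linarith
      · linarith
      · nlinarith
    _ = M ^ 10 := by ring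

end NormingForms

/-! ### From the gradient to the norm of a projection. -/

namespace NormingForms

variable {ι X : Type*} [Fintype ι] [NormedAddCommGroup X] [NormedSpace ℝ X]
  {f : ι → X →ₗ[ℝ] ℝ} {m : ℕ} {K M : ℝ}

/-- Moving from `y` in the direction `v` or `-v` decreases the norm if the gradient of the norm
at `y` does not vanish on `v`. -/
theorem exists_norm_add_smul_pow_le (hf : NormingForms f m K M) {v y : X} (hv : ‖v‖ = 1)
    (hy : ‖y‖ ≤ M ^ 10) (hgrad : 1 / (M * 2 ^ (m + 1)) ≤ |∑ j, f j v * f j y ^ m|) :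
    ∃ t : ℝ, ‖y + t • v‖ ^ (m + 1) ≤ ‖y‖ ^ (m + 1) - 1 / M ^ (13 * m + 18) := by
  have hM := hf.le_M
  have hM0 : 0 < M := by linarith
  have hM1 : 1 ≤ M := by linarith
  set G := ∑ j, f j v * f j y ^ m with hG
  -- The step length makes the total second-order error at most `τ / M ^ (m + 3)`, a factor `M`
  -- below the first-order gain `τ / M ^ (m + 2)`.
  set τ : ℝ := 1 / M ^ (12 * m + 15) with hτ
  have hτ0 : 0 < τ := by positivity
  have hτ1 : τ ≤ 1 := by
    rw [hτ, div_le_one (by positivity)]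
    exact one_le_pow₀ hM1
  obtain ⟨s, hs, hsG⟩ : ∃ s : ℝ, |s| = 1 ∧ s * G = -|G| := by
    rcases abs_choice G with h | h
    · exact ⟨-1, by simp, by rw [h]; ring⟩
    · exact ⟨1, by simp, by rw [h]; ring⟩
  refine ⟨s * τ, ?_⟩
  have hstep : ∀ j, f j (y + (s * τ) • v) ^ (m + 1) ≤ f j y ^ (m + 1) +
      (m + 1) * τ * (s * (f j v * f j y ^ m)) + τ ^ 2 * (2 * M ^ 10) ^ (m + 1) := by
    intro j
    have hd : |s * τ * f j v| ≤ τ := by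
      rw [abs_mul, abs_mul, hs, one_mul, abs_of_pos hτ0]
      exact mul_le_of_le_one_right hτ0.le ((hf.abs_le j v).trans_eq hv)
    have h1 := add_pow_le_taylor (a := f j y) (hd.trans hτ1) m
    have h2 : (s * τ * f j v) ^ 2 * (|f j y| + 1) ^ (m + 1) ≤ τ ^ 2 * (2 * M ^ 10) ^ (m + 1) := by
      gcongr ?_ * ?_ ^ (m + 1)
      · rw [← sq_abs]
        gcongr
      · have h3 := (hf.abs_le j y).trans hy
        have h4 : 1 ≤ M ^ 10 := one_le_pow₀ hM1
        linarith
    rw [map_add, map_smul, smul_eq_mul]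
    refine h1.trans ?_
    linarith [h2]
  have hsum : ‖y + (s * τ) • v‖ ^ (m + 1) ≤ ‖y‖ ^ (m + 1) + (m + 1) * τ * (s * G) +
      Fintype.card ι * (τ ^ 2 * (2 * M ^ 10) ^ (m + 1)) := by
    rw [hf.norm_pow, hf.norm_pow]
    refine (Finset.sum_le_sum fun j _ => hstep j).trans_eq ?_
    rw [Finset.sum_add_distrib, Finset.sum_add_distrib, ← Finset.mul_sum, ← Finset.mul_sum,
      Finset.sum_const, Finset.card_univ, nsmul_eq_mul]
  have h2M : (2 : ℝ) ^ (m + 1) ≤ M ^ (m + 1) := by gcongr; linarith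
  have hGlow : 1 / M ^ (m + 2) ≤ |G| := by
    refine le_trans ?_ hgrad
    rw [pow_succ' M (m + 1)]
    gcongr
  have hcard : (Fintype.card ι : ℝ) ≤ M := by
    refine le_trans ?_ hf.exponent_le
    exact_mod_cast hf.card_le
  have herr : Fintype.card ι * (τ ^ 2 * (2 * M ^ 10) ^ (m + 1)) ≤ τ * (1 / M ^ (m + 3)) := by
    calc (Fintype.card ι : ℝ) * (τ ^ 2 * (2 * M ^ 10) ^ (m + 1))
        ≤ M * (τ ^ 2 * (M * M ^ 10) ^ (m + 1)) := by gcongr; linarith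
      _ = τ * (τ * M ^ (11 * m + 12)) := by ring
      _ = τ * (1 / M ^ (m + 3)) := by
        rw [hτ, show 12 * m + 15 = (11 * m + 12) + (m + 3) by ring, pow_add]
        field_simp
  have hmain : τ * |G| ≤ (m + 1) * τ * |G| := by
    have : (0 : ℝ) ≤ m * (τ * |G|) := by positivity
    linarith
  have hτG : τ * (1 / M ^ (m + 2)) ≤ τ * |G| := by gcongr
  have hsplit : τ * (1 / M ^ (m + 2)) = M * (τ * (1 / M ^ (m + 3))) := by
    rw [pow_succ M (m + 2)]
    field_simp
  have hfin : 1 / M ^ (13 * m + 18) = τ * (1 / M ^ (m + 3)) := by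
    rw [hτ, show 13 * m + 18 = (12 * m + 15) + (m + 3) by ring, pow_add]
    field_simp
  have hpos : 0 < τ * (1 / M ^ (m + 3)) := by positivity
  have h98 : 98 * (τ * (1 / M ^ (m + 3))) ≤ M * (τ * (1 / M ^ (m + 3))) := by gcongr
  rw [hfin]
  rw [hsG] at hsum
  linarith

theorem le_opNorm_projection [DecidableEq ι] [FiniteDimensional ℝ X] (hf : NormingForms f m K M)
    {Y : Submodule ℝ X} (hY : Module.finrank ℝ Y + 1 = Module.finrank ℝ X) {P : X →L[ℝ] Y}
    (hP : P ∈ projections Y) : 1 + 1 / M ^ (24 * m + 30) ≤ ‖P‖ := by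
  have hM := hf.le_M
  have hM0 : 0 < M := by linarith
  have hM1 : 1 ≤ M := by linarith
  obtain ⟨g, hg, hker, x₀, hx₀, hgx₀⟩ : ∃ g : X →ₗ[ℝ] ℝ, (∀ x, |g x| ≤ ‖x‖) ∧
      (∀ x, g x = 0 → x ∈ Y) ∧ ∃ x₀, ‖x₀‖ ≤ 1 ∧ 1 / 2 ≤ |g x₀| := by
    have hlt : Y < ⊤ := by
      refine lt_top_iff_ne_top.2 fun h => ?_
      rw [h, finrank_top] at hY
      omega
    obtain ⟨g₀, hg₀, hYg₀⟩ := Submodule.exists_le_ker_of_lt_top Y hlt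
    have hkerY : Y = LinearMap.ker g₀ := by
      refine Submodule.eq_of_le_of_finrank_eq hYg₀ ?_
      have h1 := Module.Dual.finrank_ker_add_one_of_ne_zero (f := g₀) hg₀
      omega
    set g₁ : X →L[ℝ] ℝ := LinearMap.toContinuousLinearMap g₀ with hg₁
    have hg₁0 : 0 < ‖g₁‖ := by
      refine norm_pos_iff.2 fun h => hg₀ ?_
      ext x
      exact congrArg (fun L : X →L[ℝ] ℝ => L x) h
    refine ⟨‖g₁‖⁻¹ • g₀, fun x => ?_, fun x hx => ?_, ?_⟩
    · have := g₁.le_opNorm x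
      rw [LinearMap.smul_apply, smul_eq_mul, abs_mul, abs_inv, abs_norm, inv_mul_le_iff₀ hg₁0]
      exact this
    · rw [hkerY, LinearMap.mem_ker]
      simpa [hg₁0.ne'] using hx
    · obtain ⟨x, hx, hgx⟩ := g₁.exists_lt_apply_of_lt_opNorm (r := ‖g₁‖ / 2) (by linarith)
      refine ⟨x, hx.le, ?_⟩
      rw [LinearMap.smul_apply, smul_eq_mul, abs_mul, abs_inv, abs_norm, inv_mul_eq_div,
        le_div_iff₀ hg₁0]
      have : ‖g₁ x‖ = |g₀ x| := rfl
      linarith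
  obtain ⟨v, hv, hPv⟩ : ∃ v, ‖v‖ = 1 ∧ P v = 0 := by
    obtain ⟨u, hu, hu0⟩ := (Submodule.ne_bot_iff _).1
      (LinearMap.ker_ne_bot_of_finrank_lt (f := (P : X →ₗ[ℝ] Y)) (by omega))
    refine ⟨‖u‖⁻¹ • u, ?_, ?_⟩
    · rw [norm_smul, norm_inv, norm_norm, inv_mul_cancel₀ (norm_ne_zero_iff.2 hu0)]
    · have : P u = 0 := hu
      rw [map_smul, this, smul_zero]
  obtain ⟨y, hgy, hy, hgrad⟩ := hf.exists_le_abs_gradient hg hx₀ hgx₀ hv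
  obtain ⟨t, ht⟩ := hf.exists_norm_add_smul_pow_le hv hy hgrad
  have hyP : ‖y‖ ≤ ‖P‖ * ‖y + t • v‖ := by
    have h1 : P (y + t • v) = ⟨y, hker y hgy⟩ := by
      rw [map_add, map_smul, hPv, smul_zero, add_zero]
      exact hP ⟨y, hker y hgy⟩
    have h2 := P.le_opNorm (y + t • v)
    rwa [h1] at h2
  by_contra! hlt
  -- The exponent is `(11 * m + 11) + (13 * m + 18) + 1`: the first summand bounds the amplification
  -- of `ε`, the second is the guaranteed drop `D`, and the 1 makes the excess `D / M` smaller than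
  -- that drop.
  set ε : ℝ := 1 / M ^ (24 * m + 30) with hε
  have hε0 : 0 ≤ ε := by positivity
  have hε1 : ε ≤ 1 := by
    rw [hε, div_le_one (by positivity)]
    exact one_le_pow₀ hM1
  set D : ℝ := 1 / M ^ (13 * m + 18) with hD
  have hD0 : 0 < D := by positivity
  have hA0 : 0 ≤ ‖y‖ ^ (m + 1) := by positivity
  have hB0 : 0 ≤ ‖y + t • v‖ ^ (m + 1) := by positivity
  have h1 : ‖y‖ ^ (m + 1) ≤ (1 + (2 ^ (m + 1) - 1) * ε) * ‖y + t • v‖ ^ (m + 1) := by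
    calc ‖y‖ ^ (m + 1) ≤ (‖P‖ * ‖y + t • v‖) ^ (m + 1) := by gcongr
      _ = ‖P‖ ^ (m + 1) * ‖y + t • v‖ ^ (m + 1) := mul_pow _ _ _
      _ ≤ (1 + ε) ^ (m + 1) * ‖y + t • v‖ ^ (m + 1) := by gcongr
      _ ≤ _ := by
        gcongr
        exact one_add_pow_le_one_add_two_pow_sub_one_mul hε0 hε1 _
  have h2 : (2 ^ (m + 1) - 1) * ε * ‖y + t • v‖ ^ (m + 1) ≤
      M ^ (m + 1) * ε * (M ^ 10) ^ (m + 1) := by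
    have h3 : (2 : ℝ) ^ (m + 1) ≤ M ^ (m + 1) := by gcongr; linarith
    have h4 : ‖y + t • v‖ ^ (m + 1) ≤ (M ^ 10) ^ (m + 1) := by
      have : ‖y‖ ^ (m + 1) ≤ (M ^ 10) ^ (m + 1) := by gcongr
      linarith
    gcongr
    linarith
  have h5 : M ^ (m + 1) * ε * (M ^ 10) ^ (m + 1) = D / M := by
    rw [hε, hD, show 24 * m + 30 = (11 * m + 11) + (13 * m + 18) + 1 by ring]
    simp only [pow_add]
    field_simp
    ring
  have h6 : D / M < D := div_lt_self hD0 (by linarith)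
  linarith

/-- Raising the exponent by one keeps the inequality strict after passing to the infimum. -/
theorem lt_relProjConst [DecidableEq ι] [FiniteDimensional ℝ X] (hf : NormingForms f m K M)
    {Y : Submodule ℝ X} (hY : Module.finrank ℝ Y + 1 = Module.finrank ℝ X) :
    1 + 1 / M ^ (24 * m + 31) < relProjConst Y := by
  have hM := hf.le_M
  have hM0 : 0 < M := by linarith
  have h1 : 1 + 1 / M ^ (24 * m + 30) ≤ relProjConst Y := by
    refine le_csInf ((projections_nonempty Y).image _) ?_
    rintro _ ⟨P, hP, rfl⟩
    exact hf.le_opNorm_projection hY hP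
  refine lt_of_lt_of_le ?_ h1
  gcongr
  · linarith
  · omega

end NormingForms

/-! ### General position of the explicit forms. -/

section ExplicitForms

/-- The columns of the two linear relations among the `n + 2` forms `functionals n`. -/
noncomputable def relationColumn (n : ℕ) : Fin (n + 2) → ℝ × ℝ :=
  Fin.append (fun j : Fin n => (1, (j : ℝ) + 1)) ![(-1, 0), (0, -(n : ℝ))]

/-- The `2 × 2` minors of the matrix of relations. -/
noncomputable def relationMinor (n : ℕ) (i j : Fin (n + 2)) : ℝ :=
  (relationColumn n i).1 * (relationColumn n j).2 - (relationColumn n j).1 * (relationColumn n i).2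

theorem relationMinor_self (n : ℕ) (i : Fin (n + 2)) : relationMinor n i i = 0 := by
  simp only [relationMinor]
  ring

/-- Off the diagonal the minors are, up to sign, the nonzero integers `j - i`, `j + 1` and `n`. This
is the quantitative source of general position. -/
theorem abs_relationMinor_bounds {n : ℕ} (hn : n ≠ 0) {i j : Fin (n + 2)} (hij : i ≠ j) :
    1 ≤ |relationMinor n i j| ∧ |relationMinor n i j| ≤ n := by
  have key : ∀ z : ℤ, z ≠ 0 → |z| ≤ n → 1 ≤ |(z : ℝ)| ∧ |(z : ℝ)| ≤ n := fun z h0 h1 =>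
    ⟨by exact_mod_cast Int.one_le_abs h0, by exact_mod_cast h1⟩
  have of_eq : ∀ {r : ℝ} (z : ℤ), r = z → z ≠ 0 → |z| ≤ n → 1 ≤ |r| ∧ |r| ≤ n := by
    rintro r z rfl h0 h1
    exact key z h0 h1
  simp only [relationMinor, relationColumn]
  induction i using Fin.addCases with
  | left i =>
    have hi := i.isLt
    induction j using Fin.addCases with
    | left j =>
      have hj := j.isLt
      have hne : (i : ℕ) ≠ j := fun h => hij (by rw [Fin.ext h])
      refine of_eq ((j : ℤ) - i) ?_ (by omega) (abs_le.2 ⟨by omega, by omega⟩)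
      simp
    | right j =>
      fin_cases j
      · refine of_eq ((i : ℤ) + 1) ?_ (by omega) (abs_le.2 ⟨by omega, by omega⟩)
        simp
      · refine of_eq (-(n : ℤ)) ?_ (by omega) (abs_le.2 ⟨by omega, by omega⟩)
        simp
  | right i =>
    induction j using Fin.addCases with
    | left j =>
      have hj := j.isLt
      fin_cases i
      · refine of_eq (-((j : ℤ) + 1)) ?_ (by omega) (abs_le.2 ⟨by omega, by omega⟩)
        simp
      · refine of_eq (n : ℤ) ?_ (by omega) (abs_le.2 ⟨by omega, by omega⟩)
        simp
    | right j =>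
      fin_cases i <;> fin_cases j
      · exact absurd rfl hij
      · refine of_eq (n : ℤ) ?_ (by omega) (abs_le.2 ⟨by omega, by omega⟩)
        simp
      · refine of_eq (-(n : ℤ)) ?_ (by omega) (abs_le.2 ⟨by omega, by omega⟩)
        simp
      · exact absurd rfl hij

theorem functionals_castAdd (n : ℕ) (i : Fin n) (x : Fin n → ℝ) :
    functionals n (Fin.castAdd 2 i) x = x i := by
  simp [functionals]

theorem functionals_natAdd_zero (n : ℕ) (x : Fin n → ℝ) :
    functionals n (Fin.natAdd n 0) x = ∑ j, x j := by
  simp [functionals]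

theorem functionals_natAdd_one (n : ℕ) (x : Fin n → ℝ) :
    functionals n (Fin.natAdd n 1) x = (n : ℝ)⁻¹ * ∑ j : Fin n, ((j : ℝ) + 1) * x j := by
  simp [functionals]

variable {n : ℕ}

/-- This is the combination of the two relations in which the form `b` is eliminated. -/
theorem sum_functionals_mul_relationMinor (hn : n ≠ 0) (x : Fin n → ℝ) (b : Fin (n + 2)) :
    ∑ k, functionals n k x * relationMinor n k b = 0 := by
  have hn' : (n : ℝ) ≠ 0 := Nat.cast_ne_zero.2 hn
  have h1 : ∑ k, functionals n k x * (relationColumn n k).1 = 0 := by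
    simp [Fin.sum_univ_add, functionals_castAdd, functionals_natAdd_zero, functionals_natAdd_one,
      relationColumn]
  have h2 : ∑ k, functionals n k x * (relationColumn n k).2 = 0 := by
    simp only [Fin.sum_univ_add, functionals_castAdd, functionals_natAdd_zero,
      functionals_natAdd_one, relationColumn, Fin.append_left, Fin.append_right,
      Fin.sum_univ_two, Matrix.cons_val_zero, Matrix.cons_val_one, mul_zero, zero_add]
    rw [mul_neg, mul_right_comm, inv_mul_cancel₀ hn', one_mul, add_neg_eq_zero]
    exact Finset.sum_congr rfl fun _ _ => mul_comm _ _
  have h3 : ∀ k, functionals n k x * relationMinor n k b =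
      functionals n k x * (relationColumn n k).1 * (relationColumn n b).2 -
        functionals n k x * (relationColumn n k).2 * (relationColumn n b).1 := by
    intro k
    simp only [relationMinor]
    ring
  simp_rw [h3]
  rw [Finset.sum_sub_distrib, ← Finset.sum_mul, ← Finset.sum_mul, h1, h2]
  ring

theorem exists_functionals_eq (hn : n ≠ 0) {z : Fin (n + 2) → ℝ}
    (h1 : ∑ k, z k * (relationColumn n k).1 = 0) (h2 : ∑ k, z k * (relationColumn n k).2 = 0) :
    ∃ x, ∀ k, functionals n k x = z k := by
  have hn' : (n : ℝ) ≠ 0 := Nat.cast_ne_zero.2 hn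
  refine ⟨fun j => z (Fin.castAdd 2 j), fun k => ?_⟩
  simp only [Fin.sum_univ_add, relationColumn, Fin.append_left, Fin.append_right,
      Fin.sum_univ_two, Matrix.cons_val_zero, Matrix.cons_val_one, mul_zero, zero_add,
      mul_one, add_zero] at h1 h2
  induction k using Fin.addCases with
  | left k => rw [functionals_castAdd]
  | right k =>
    fin_cases k
    · refine (functionals_natAdd_zero n _).trans ?_
      simp only [Fin.zero_eta] at *
      linarith
    · refine (functionals_natAdd_one n _).trans ?_
      simp only [Fin.mk_one] at *
      rw [inv_mul_eq_div, div_eq_iff hn']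
      simp_rw [mul_comm ((_ : ℝ) + 1)]
      linarith

/-- Any three of the forms are the only ones that do not vanish on a suitable vector. -/
theorem exists_functionals_dual (hn : n ≠ 0) {i a b : Fin (n + 2)} (hia : i ≠ a) (hib : i ≠ b)
    (hab : a ≠ b) : ∃ x, functionals n i x = 1 ∧
      (∀ j, j ≠ i → j ≠ a → j ≠ b → functionals n j x = 0) ∧
      ∑ j, |functionals n j x| ≤ 2 * n + 1 := by
  have hm1 := (abs_relationMinor_bounds hn hab).1
  have hm0 : relationMinor n a b ≠ 0 := abs_pos.1 (by linarith)
  -- Cramer's rule: `α` and `β` solve column `i` + `α` column `a` + `β` column `b` = 0.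
  set α := relationMinor n b i / relationMinor n a b with hα
  set β := relationMinor n i a / relationMinor n a b with hβ
  have hα1 : |α| ≤ n := by
    rw [hα, abs_div]
    exact (div_le_self (abs_nonneg _) hm1).trans (abs_relationMinor_bounds hn hib.symm).2
  have hβ1 : |β| ≤ n := by
    rw [hβ, abs_div]
    exact (div_le_self (abs_nonneg _) hm1).trans (abs_relationMinor_bounds hn hia).2
  set z : Fin (n + 2) → ℝ := Pi.single i 1 + Pi.single a α + Pi.single b β with hz
  have hsum : ∀ c : Fin (n + 2) → ℝ, ∑ k, z k * c k = c i + α * c a + β * c b := by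
    intro c
    simp [hz, add_mul, Finset.sum_add_distrib, Pi.single_apply]
  obtain ⟨x, hx⟩ := exists_functionals_eq (z := z) hn
    (by
      rw [hsum, hα, hβ]
      field_simp
      simp only [relationMinor]
      ring)
    (by
      rw [hsum, hα, hβ]
      field_simp
      simp only [relationMinor]
      ring)
  refine ⟨x, ?_, fun j hji hja hjb => ?_, ?_⟩
  · rw [hx, hz]
    simp [hia, hib]
  · rw [hx, hz]
    simp [hji, hja, hjb]
  · calc ∑ j, |functionals n j x|
        ≤ ∑ j, (Pi.single i 1 j + Pi.single a |α| j + Pi.single b |β| j) := by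
          refine Finset.sum_le_sum fun j _ => ?_
          rw [hx, hz]
          refine (abs_add_three _ _ _).trans_eq ?_
          simp only [Pi.single_apply, apply_ite abs, abs_one, abs_zero]
      _ = 1 + |α| + |β| := by simp [Finset.sum_add_distrib]
      _ ≤ 2 * n + 1 := by linarith

/-- The relation with `b` eliminated expresses form `a` through the forms outside `{a, b}`, with
coefficients at most `n`; the same holds with `a` and `b` exchanged. -/
theorem sum_abs_functionals_le (hn : n ≠ 0) {a b : Fin (n + 2)} (hab : a ≠ b) (x : Fin n → ℝ) :
    ∑ k, |functionals n k x| ≤ (2 * n + 1) * ∑ k ∈ {a, b}ᶜ, |functionals n k x| := by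
  have hsplit : ∀ c : Fin (n + 2) → ℝ, ∑ k, c k = c a + c b + ∑ k ∈ {a, b}ᶜ, c k := by
    intro c
    rw [← Finset.sum_pair hab, Finset.sum_add_sum_compl]
  have key : ∀ a b : Fin (n + 2), a ≠ b →
      |functionals n a x| ≤ n * ∑ k ∈ {a, b}ᶜ, |functionals n k x| := by
    intro a b hab
    have h1 := sum_functionals_mul_relationMinor hn x b
    rw [← Finset.sum_add_sum_compl {a, b}, Finset.sum_pair hab, relationMinor_self, mul_zero,
      add_zero] at h1
    have h2 : |functionals n a x * relationMinor n a b| ≤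
        n * ∑ k ∈ {a, b}ᶜ, |functionals n k x| := by
      rw [eq_neg_of_add_eq_zero_left h1, abs_neg, Finset.mul_sum]
      refine (Finset.abs_sum_le_sum_abs _ _).trans (Finset.sum_le_sum fun k hk => ?_)
      have hkb : k ≠ b := by
        rintro rfl
        simp at hk
      rw [abs_mul, mul_comm]
      gcongr
      exact (abs_relationMinor_bounds hn hkb).2
    refine le_trans ?_ h2
    rw [abs_mul]
    exact le_mul_of_one_le_right (abs_nonneg _) (abs_relationMinor_bounds hn hab).1
  have h1 := key a b hab
  have h2 := key b a hab.symm
  rw [Finset.pair_comm b a] at h2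
  rw [← Finset.sum_add_sum_compl {a, b}, Finset.sum_pair hab]
  linarith

theorem halfExponent_bounds (n : ℕ) : n + 2 ≤ 2 * halfExponent n ∧ 2 * halfExponent n ≤ n + 3 := by
  constructor
  · have h1 : ((n : ℝ) + 2) / 2 ≤ halfExponent n := Nat.le_ceil _
    have h2 : (n : ℝ) + 2 ≤ 2 * halfExponent n := by linarith
    exact_mod_cast h2
  · have h1 : (halfExponent n : ℝ) < ((n : ℝ) + 2) / 2 + 1 := Nat.ceil_lt_add_one (by positivity)
    have h2 : 2 * (halfExponent n : ℝ) < n + 4 := by linarith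
    have h3 : 2 * halfExponent n < n + 4 := by exact_mod_cast h2
    omega

variable {X : Type*} [NormedAddCommGroup X] [NormedSpace ℝ X]

theorem normingForms_functionals (hn : 4 ≤ n) (e : X ≃ₗ[ℝ] (Fin n → ℝ))
    (he : ∀ x, ‖x‖ = explicitNorm n (e x)) :
    NormingForms (fun i => functionals n i ∘ₗ e.toLinearMap) (2 * halfExponent n - 1)
      (2 * n + 1) (2 * ((n : ℝ) + 3) ^ 2) := by
  obtain ⟨hp1, hp2⟩ := halfExponent_bounds n
  have hn4 : (4 : ℝ) ≤ n := by exact_mod_cast hn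
  have hn0 : n ≠ 0 := by omega
  have hm : 2 * halfExponent n - 1 + 1 = 2 * halfExponent n := by omega
  have hnorm_abs : ∀ x, ‖x‖ ^ (2 * halfExponent n) =
      ∑ i, |functionals n i (e x)| ^ (2 * halfExponent n) := by
    intro x
    rw [he, explicitNorm, ← Real.rpow_natCast, ← Real.rpow_mul (by positivity)]
    push_cast
    rw [one_div_mul_cancel, Real.rpow_one]
    have : 0 < halfExponent n := by omega
    positivity
  have hle : ∀ i x, |functionals n i (e x)| ≤ ‖x‖ := by
    intro i x
    refine le_of_pow_le_pow_left₀ (n := 2 * halfExponent n) (by omega) (norm_nonneg _) ?_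
    rw [hnorm_abs]
    exact Finset.single_le_sum (f := fun i => |functionals n i (e x)| ^ (2 * halfExponent n))
      (fun i _ => by positivity) (Finset.mem_univ i)
  have hsum : ∀ x, ‖x‖ ≤ ∑ i, |functionals n i (e x)| := by
    intro x
    refine le_of_pow_le_pow_left₀ (n := 2 * halfExponent n) (by omega)
      (Finset.sum_nonneg fun _ _ => abs_nonneg _) ?_
    rw [hnorm_abs, ← hm]
    simp_rw [pow_succ']
    rw [Finset.sum_mul]
    gcongr with i
    exact Finset.single_le_sum (f := fun i => |functionals n i (e x)|)
      (fun i _ => abs_nonneg _) (Finset.mem_univ i)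
  refine
    { odd := ⟨halfExponent n - 1, by omega⟩
      six_le_card := by rw [Fintype.card_fin]; omega
      card_le := by rw [Fintype.card_fin]; omega
      one_le_K := by linarith
      K_le := by nlinarith
      exponent_le := ?_
      le_M := by nlinarith
      norm_pow := fun x => ?_
      abs_le := hle
      dual := fun i a b hia hib hab => ?_
      norm_le := fun a b hab x => ?_ }
  · have h1 : ((2 * halfExponent n - 1 + 1 : ℕ) : ℝ) ≤ ((n + 3 : ℕ) : ℝ) := by
      exact_mod_cast hm.trans_le hp2
    push_cast at h1
    nlinarith
  · rw [hm, hnorm_abs]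
    refine Finset.sum_congr rfl fun i _ => ?_
    exact (even_two_mul _).pow_abs _
  · obtain ⟨x, h1, h2, h3⟩ := exists_functionals_dual hn0 hia hib hab
    refine ⟨e.symm x, by simpa using h1, fun j hji hja hjb => by simpa using h2 j hji hja hjb, ?_⟩
    refine (hsum _).trans ?_
    simpa using h3
  -- If all `n` remaining forms were below `‖x‖ / M`, summing would give `M * ‖x‖ ≤ (2 * n + 1) * n
  -- * ‖x‖`, but `M = 2 * (n + 3) ^ 2` is larger.
  · by_contra! h
    have hcard : (({a, b}ᶜ : Finset (Fin (n + 2))).card : ℝ) = n := by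
      rw [Finset.card_compl, Finset.card_pair hab, Fintype.card_fin, Nat.add_sub_cancel]
    have hlt : ∀ k ∈ ({a, b}ᶜ : Finset (Fin (n + 2))),
        2 * ((n : ℝ) + 3) ^ 2 * |functionals n k (e x)| < ‖x‖ := by
      intro k hk
      simp only [Finset.mem_compl, Finset.mem_insert, Finset.mem_singleton, not_or] at hk
      exact h k hk.1 hk.2
    have hpos : 0 < ‖x‖ := by
      have hne : ({a, b}ᶜ : Finset (Fin (n + 2))).Nonempty := by
        rw [← Finset.card_pos, ← Nat.cast_pos (α := ℝ), hcard]
        linarith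
      obtain ⟨k, hk⟩ := hne
      exact lt_of_le_of_lt (by positivity) (hlt k hk)
    have h1 := Finset.sum_le_card_nsmul _ _ _ fun k hk => (hlt k hk).le
    rw [← Finset.mul_sum, nsmul_eq_mul, hcard] at h1
    have h2 := (hsum x).trans (sum_abs_functionals_le hn0 hab (e x))
    have h3 : 2 * ((n : ℝ) + 3) ^ 2 * ‖x‖ ≤ (2 * n + 1) * (n * ‖x‖) := by
      calc 2 * ((n : ℝ) + 3) ^ 2 * ‖x‖ ≤ 2 * ((n : ℝ) + 3) ^ 2 *
            ((2 * n + 1) * ∑ k ∈ {a, b}ᶜ, |functionals n k (e x)|) := by gcongr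
        _ = (2 * n + 1) * (2 * ((n : ℝ) + 3) ^ 2 * ∑ k ∈ {a, b}ᶜ, |functionals n k (e x)|) := by
          ring
        _ ≤ (2 * n + 1) * (n * ‖x‖) := by gcongr
    nlinarith

/-- The forms embed `ℝⁿ` into the `ℓ`-space of exponent `2p` and dimension `n + 2`; the norm is
inherited from there. -/
theorem exists_normedSpace_explicitNorm (n : ℕ) :
    ∃ (X : Type) (_ : NormedAddCommGroup X) (_ : NormedSpace ℝ X) (e : X ≃ₗ[ℝ] (Fin n → ℝ)),
      ∀ x : X, ‖x‖ = explicitNorm n (e x) := by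
  have hp := (halfExponent_bounds n).1
  have : Fact (1 ≤ ((2 * halfExponent n : ℕ) : ENNReal)) :=
    ⟨by exact_mod_cast (by omega : 1 ≤ 2 * halfExponent n)⟩
  let T : (Fin n → ℝ) →ₗ[ℝ] PiLp ((2 * halfExponent n : ℕ) : ENNReal) (fun _ : Fin (n + 2) => ℝ) :=
    (WithLp.linearEquiv _ ℝ (Fin (n + 2) → ℝ)).symm.toLinearMap ∘ₗ LinearMap.pi (functionals n)
  have hT : ∀ x i, T x i = functionals n i x := fun x i => rfl
  have hinj : Function.Injective T := by
    intro x y hxy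
    ext j
    have := congrArg (fun z => z (Fin.castAdd 2 j)) hxy
    simpa only [hT, functionals_castAdd] using this
  refine ⟨LinearMap.range T, inferInstance, inferInstance,
    (LinearEquiv.ofInjective T hinj).symm, fun x => ?_⟩
  obtain ⟨y, rfl⟩ := (LinearEquiv.ofInjective T hinj).surjective x
  rw [LinearEquiv.symm_apply_apply, Submodule.coe_norm, LinearEquiv.ofInjective_apply,
    PiLp.norm_eq_sum (by
      rw [ENNReal.toReal_natCast]
      exact_mod_cast (by omega : 0 < 2 * halfExponent n)), explicitNorm]
  simp only [ENNReal.toReal_natCast, Real.rpow_natCast, hT, Real.norm_eq_abs]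
  push_cast
  rfl

end ExplicitForms

theorem corollary1p2 (n : ℕ) (hn : 4 ≤ n) :
    ∃ (X : Type) (_ : NormedAddCommGroup X) (_ : NormedSpace ℝ X),
      Module.finrank ℝ X = n ∧
      (∃ e : X ≃ₗ[ℝ] (Fin n → ℝ), ∀ x : X, ‖x‖ = explicitNorm n (e x)) ∧
      ∀ Y : Submodule ℝ X, Module.finrank ℝ Y = n - 1 →
        relProjConst Y >
          1 + (2 * ((n : ℝ) + 3) ^ 2) ^ (-(100 * ((n : ℤ) + 3) ^ 2)) := by
  obtain ⟨X, _, _, e, he⟩ := exists_normedSpace_explicitNorm n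
  have hfin : Module.finrank ℝ X = n := by
    rw [e.finrank_eq, Module.finrank_fin_fun]
  refine ⟨X, inferInstance, inferInstance, hfin, ⟨e, he⟩, fun Y hY => ?_⟩
  have : FiniteDimensional ℝ X := e.symm.finiteDimensional
  have hf := normingForms_functionals hn e he
  refine lt_of_le_of_lt ?_ (hf.lt_relProjConst (Y := Y) (by omega))
  have hp := (halfExponent_bounds n).2
  have hexp : 24 * (2 * halfExponent n - 1) + 31 ≤ 100 * (n + 3) ^ 2 := by
    have h1 : n + 3 ≤ (n + 3) ^ 2 := Nat.le_self_pow two_ne_zero _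
    omega
  have hz : -(100 * ((n : ℤ) + 3) ^ 2) = -((100 * (n + 3) ^ 2 : ℕ) : ℤ) := by push_cast; ring
  have hM : 1 ≤ 2 * ((n : ℝ) + 3) ^ 2 := by linarith [hf.le_M]
  rw [hz, zpow_neg, zpow_natCast, ← one_div]
  exact add_le_add_right (one_div_pow_le_one_div_pow_of_le hM hexp) 1
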